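/- Let $H_1,H_2$ be infinite-dimensional separable complex Hilbert spaces, let $A_j\in\mathcal B(H_j)$ be positive for $j=1,2$, and let $X\in\mathcal B(H_2,H_1)$ be a bounded linear operator. Suppose that the bounded operator $$T=\begin{bmatrix}A_1&X\\ X^*&A_2\end{bmatrix}$$ on the Hilbert direct sum $H_1\oplus H_2$ is positive. An operator $S\in\mathcal B(H)$ is called absolutely minimum attaining if for every nonzero closed subspace $M\subseteq H$ there is a unit vector $x_0\in M$ with $\|Sx_0\|=\inf\{\|Sx\|:x\in M,\ \|x\|=1\}$, and its essential spectrum is $\sigma_{ess}(S)=\{\mu\in\mathbb C: S-\mu I\text{ is not Fredholm}\}$. If $T$ is absolutely minimum attaining, then $A_1$ and $A_2$ are absolutely minimum attaining, $\sigma_{ess}(A_1)=\sigma_{ess}(A_2)$, and $X$ is compact. -/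

import Mathlib

noncomputable section

section MinimumAttaining

variable {E F : Type*}
  [NormedAddCommGroup E] [InnerProductSpace ℂ E]
  [NormedAddCommGroup F] [InnerProductSpace ℂ F]

/-- The minimum modulus `m(T) = inf {‖T x‖ : ‖x‖ = 1}`. -/
def minModulus (T : E →L[ℂ] F) : ℝ :=
  sInf {r : ℝ | ∃ x : E, ‖x‖ = 1 ∧ ‖T x‖ = r}

/-- `T` is minimum attaining: `‖T x‖ = m(T)` for some unit vector `x`. -/
def IsMinAttaining (T : E →L[ℂ] F) : Prop :=
  ∃ x : E, ‖x‖ = 1 ∧ ‖T x‖ = minModulus T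

/-- `T` is absolutely minimum attaining: its restriction to every nonzero closed subspace is
minimum attaining. -/
def IsAbsMinAttaining (T : E →L[ℂ] F) : Prop :=
  ∀ M : Submodule ℂ E, IsClosed (M : Set E) → M ≠ ⊥ → IsMinAttaining (T ∘L M.subtypeL)

/-- The essential spectrum: those `μ` for which `T - μ I` is not Fredholm. -/
def essSpectrum (T : E →L[ℂ] E) : Set ℂ :=
  {μ : ℂ | ¬ (T - μ • ContinuousLinearMap.id ℂ E).IsFredholm}

end MinimumAttaining

section Block

variable {H₁ H₂ : Type*}
  [NormedAddCommGroup H₁] [InnerProductSpace ℂ H₁]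
  [NormedAddCommGroup H₂] [InnerProductSpace ℂ H₂]

/-- The operator `(x₁, x₂) ↦ (A x₁ + B x₂, C x₁ + D x₂)` with block matrix `[[A, B], [C, D]]` on the
Hilbert direct sum `H₁ ⊕ H₂`. -/
def blockOperator (A : H₁ →L[ℂ] H₁) (B : H₂ →L[ℂ] H₁) (C : H₁ →L[ℂ] H₂) (D : H₂ →L[ℂ] H₂) :
    WithLp 2 (H₁ × H₂) →L[ℂ] WithLp 2 (H₁ × H₂) :=
  (WithLp.prodContinuousLinearEquiv 2 ℂ H₁ H₂).symm.toContinuousLinearMap ∘L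
    ((A.coprod B).prod (C.coprod D)) ∘L
      (WithLp.prodContinuousLinearEquiv 2 ℂ H₁ H₂).toContinuousLinearMap

theorem blockOperator_apply (A : H₁ →L[ℂ] H₁) (B : H₂ →L[ℂ] H₁) (C : H₁ →L[ℂ] H₂)
    (D : H₂ →L[ℂ] H₂) (x : WithLp 2 (H₁ × H₂)) :
    blockOperator A B C D x =
      WithLp.toLp 2 (A x.fst + B x.snd, C x.fst + D x.snd) := rfl

end Block

end

/-! A positive absolutely minimum attaining operator `T` on an infinite-dimensional space is a
compact perturbation of some scalar `β ≥ 0` (`IsAbsMinAttaining.exists_isCompactOperator_sub`). Were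
`‖T x‖ ^ 2` not asymptotically constant on the unit sphere, one could choose an orthonormal sequence
with orthogonal images whose norms decrease strictly to their limit, and on its closed span the
minimum would not be attained.

Let `J₁`, `J₂` be the inclusions of the summands. The operators `Aⱼ - β = Jⱼ* (T - β) Jⱼ` and `X =
J₁* (T - β) J₂` are then compact, so both essential spectra equal `{β}`.

Compactness of `A - β` alone does not make `A` absolutely minimum attaining: adding to `β` a
positive compact operator of infinite rank is a counterexample. What is also needed is that every
infinite-dimensional closed subspace contains some `x ≠ 0` with `⟨A x, x⟩ ≤ β ‖x‖ ^ 2`. `T` has this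
property (`IsAbsMinAttaining.exists_re_inner_le`), it visibly passes to compressions, and together
with compactness it suffices (`IsAbsMinAttaining.of_isCompactOperator_sub`). -/

/-! ### Minimum modulus. -/

theorem minModulus_le {E F : Type*} [NormedAddCommGroup E] [InnerProductSpace ℂ E]
    [NormedAddCommGroup F] [InnerProductSpace ℂ F] (T : E →L[ℂ] F) {x : E} (hx : ‖x‖ = 1) :
    minModulus T ≤ ‖T x‖ :=
  csInf_le ⟨0, by rintro _ ⟨y, -, rfl⟩; exact norm_nonneg _⟩ ⟨x, hx, rfl⟩

theorem le_minModulus {E F : Type*} [NormedAddCommGroup E] [InnerProductSpace ℂ E]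
    [NormedAddCommGroup F] [InnerProductSpace ℂ F] [Nontrivial E] (T : E →L[ℂ] F) {c : ℝ}
    (h : ∀ x : E, ‖x‖ = 1 → c ≤ ‖T x‖) : c ≤ minModulus T := by
  obtain ⟨x, hx⟩ := exists_norm_eq E zero_le_one
  refine le_csInf ⟨_, x, hx, rfl⟩ ?_
  rintro _ ⟨y, hy, rfl⟩
  exact h y hy

theorem IsMinAttaining.of_le {E F : Type*} [NormedAddCommGroup E] [InnerProductSpace ℂ E]
    [NormedAddCommGroup F] [InnerProductSpace ℂ F] {T : E →L[ℂ] F} {x : E} (hx : ‖x‖ = 1)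
    (h : ‖T x‖ ≤ minModulus T) : IsMinAttaining T :=
  ⟨x, hx, h.antisymm (minModulus_le T hx)⟩

theorem IsMinAttaining.of_finiteDimensional {E F : Type*} [NormedAddCommGroup E]
    [InnerProductSpace ℂ E] [NormedAddCommGroup F] [InnerProductSpace ℂ F] [Nontrivial E]
    [FiniteDimensional ℂ E] (T : E →L[ℂ] F) : IsMinAttaining T := by
  have : ProperSpace E := FiniteDimensional.proper ℂ E
  obtain ⟨x₀, hx₀⟩ := exists_norm_eq E zero_le_one
  obtain ⟨x, hx, hmin⟩ := (isCompact_sphere (0 : E) 1).exists_isMinOn ⟨x₀, by simpa using hx₀⟩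
    (f := fun x => ‖T x‖) (by fun_prop)
  refine .of_le (by simpa using hx) (le_minModulus T fun y hy => hmin (by simpa using hy))

/-! ### Compactness criteria. -/

theorem IsCompactOperator.of_finiteDimensional_range {E F : Type*} [NormedAddCommGroup E]
    [NormedSpace ℂ E] [NormedAddCommGroup F] [NormedSpace ℂ F] (f : E →L[ℂ] F)
    [FiniteDimensional ℂ f.range] : IsCompactOperator f := by
  have : ProperSpace f.range := FiniteDimensional.proper ℂ _
  have h : IsCompactOperator (f.codRestrict f.range fun x => LinearMap.mem_range_self _ x) :=
    isCompactOperator_of_locallyCompactSpace_dom (f.codRestrict f.range _)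
  exact h.clm_comp f.range.subtypeL

/-- Otherwise `R` is bounded below, hence a closed embedding, and the unit ball lies in the preimage
of a compact set. -/
theorem exists_norm_eq_one_norm_map_lt {E F : Type*} [NormedAddCommGroup E]
    [NormedSpace ℂ E] [CompleteSpace E] [NormedAddCommGroup F] [NormedSpace ℂ F] {R : E →L[ℂ] F}
    (hR : IsCompactOperator R) (hE : ¬ FiniteDimensional ℂ E) {ε : ℝ} (hε : 0 < ε) :
    ∃ x : E, ‖x‖ = 1 ∧ ‖R x‖ < ε := by
  by_contra! h
  apply hE
  have hb (x : E) : ‖x‖ ≤ (⟨ε⁻¹, by positivity⟩ : NNReal) * ‖R x‖ := by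
    rcases eq_or_ne x 0 with rfl | hx
    · simp
    have h1 := h ((‖x‖⁻¹ : ℂ) • x) (by simp [norm_smul, hx])
    rw [map_smul, norm_smul] at h1
    simp only [norm_inv, Complex.norm_real, norm_norm] at h1
    have hx' : 0 < ‖x‖ := norm_pos_iff.2 hx
    change _ ≤ ε⁻¹ * _
    field_simp at h1 ⊢
    linarith
  have hcl := (R.antilipschitz_of_bound hb).isClosedEmbedding R.uniformContinuous
  obtain ⟨K, hK, hKR⟩ := IsCompactOperator.image_closedBall_subset_compact (f := R.toLinearMap) hR 1
  refine .of_isCompact_closedBall₀ ℂ one_pos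
    ((hcl.isCompact_preimage hK).of_isClosed_subset Metric.isClosed_closedBall ?_)
  exact Set.image_subset_iff.1 hKR

theorem isCompactOperator_starProjection {E : Type*} [NormedAddCommGroup E]
    [InnerProductSpace ℂ E] (V : Submodule ℂ E) [FiniteDimensional ℂ V] :
    IsCompactOperator V.starProjection := by
  have : ProperSpace V := FiniteDimensional.proper ℂ _
  have h : IsCompactOperator V.orthogonalProjectionOnto :=
    isCompactOperator_of_locallyCompactSpace_dom V.orthogonalProjectionOnto
  exact h.clm_comp V.subtypeL

theorem IsCompactOperator.of_norm_le_on_orthogonal {E F : Type*} [NormedAddCommGroup E]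
    [InnerProductSpace ℂ E] [NormedAddCommGroup F] [NormedSpace ℂ F] [CompleteSpace F]
    {S : E →L[ℂ] F}
    (h : ∀ ε : ℝ, 0 < ε → ∃ V : Submodule ℂ E, FiniteDimensional ℂ V ∧
      ∀ x ∈ Vᗮ, ‖S x‖ ≤ ε * ‖x‖) : IsCompactOperator S := by
  suffices S ∈ closure {f : E →L[ℂ] F | IsCompactOperator f} from
    isClosed_setOfPred_isCompactOperator.closure_subset this
  refine Metric.mem_closure_iff.2 fun ε hε => ?_
  obtain ⟨V, hV, hS⟩ := h (ε / 2) (by positivity)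
  have hP := isCompactOperator_starProjection V
  refine ⟨S ∘L V.starProjection, hP.clm_comp S, ?_⟩
  rw [dist_eq_norm]
  refine lt_of_le_of_lt (ContinuousLinearMap.opNorm_le_bound _ (half_pos hε).le fun x => ?_)
    (half_lt_self hε)
  have hmem : x - V.starProjection x ∈ Vᗮ := V.sub_starProjection_mem_orthogonal x
  have hle : ‖x - V.starProjection x‖ ≤ ‖x‖ := by
    rw [← Submodule.starProjection_orthogonal_val]
    exact Submodule.norm_starProjection_apply_le _ _
  calc ‖(S - S ∘L V.starProjection) x‖ = ‖S (x - V.starProjection x)‖ := by simp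
    _ ≤ ε / 2 * ‖x - V.starProjection x‖ := hS _ hmem
    _ ≤ _ := by gcongr

/-- With `Q` the projection onto `Vᗮ`, `R - Q R Q` is compact, and self-adjointness lets the
Rayleigh quotient control `‖Q R Q‖`. -/
theorem IsCompactOperator.of_abs_inner_le_on_orthogonal {E : Type*} [NormedAddCommGroup E]
    [InnerProductSpace ℂ E] [CompleteSpace E] {R : E →L[ℂ] E} (hR : IsSelfAdjoint R)
    (h : ∀ ε : ℝ, 0 < ε → ∃ V : Submodule ℂ E, FiniteDimensional ℂ V ∧
      ∀ x ∈ Vᗮ, |(inner ℂ (R x) x).re| ≤ ε * ‖x‖ ^ 2) : IsCompactOperator R := by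
  suffices R ∈ closure {f : E →L[ℂ] E | IsCompactOperator f} from
    isClosed_setOfPred_isCompactOperator.closure_subset this
  refine Metric.mem_closure_iff.2 fun ε hε => ?_
  obtain ⟨V, hV, hS⟩ := h (ε / 2) (by positivity)
  have hP := isCompactOperator_starProjection V
  set Q := Vᗮ.starProjection with hQ
  have hQP : Q = 1 - V.starProjection := by
    ext x; simp [hQ, Submodule.starProjection_orthogonal_val]
  have hQsa : IsSelfAdjoint Q := isSelfAdjoint_starProjection _
  refine ⟨R - Q * R * Q, ?_, ?_⟩
  · have : R - Q * R * Q = V.starProjection ∘L R + (Q * R) ∘L V.starProjection := by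
      rw [hQP]
      ext x
      simp
      abel
    simp only [Set.mem_ofPred_eq, this]
    exact (hP.comp_clm R).add (hP.clm_comp (Q * R))
  · rw [dist_eq_norm, sub_sub_cancel]
    refine lt_of_le_of_lt ?_ (half_lt_self hε)
    have hsym : (Q * R * Q).IsSymmetric :=
      ContinuousLinearMap.isSelfAdjoint_iff_isSymmetric.1 (by
        simpa [hQsa.star_eq] using hR.conjugate Q)
    rw [ContinuousLinearMap.norm_eq_iSup_rayleighQuotient _ hsym]
    refine ciSup_le fun x => ?_
    have h1 : (inner ℂ ((Q * R * Q) x) x) = inner ℂ (R (Q x)) (Q x) := by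
      rw [mul_apply_eq_comp, mul_apply_eq_comp]
      exact (ContinuousLinearMap.isSelfAdjoint_iff_isSymmetric.1 hQsa) _ _
    have h2 := hS (Q x) (Submodule.starProjection_apply_mem _ _)
    have h3 : ‖Q x‖ ≤ ‖x‖ := Submodule.norm_starProjection_apply_le _ _
    rcases eq_or_ne x 0 with rfl | hx
    · simp; positivity
    have hx' : 0 < ‖x‖ := norm_pos_iff.2 hx
    rw [ContinuousLinearMap.rayleighQuotient, ContinuousLinearMap.reApplyInnerSelf_apply, h1,
      abs_div, div_le_iff₀ (by positivity), abs_of_nonneg (sq_nonneg ‖x‖)]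
    refine h2.trans ?_
    gcongr

/-! ### Fredholm alternative and essential spectrum. -/

open Module in
/-- The Fredholm alternative for a compact self-adjoint operator. -/
theorem IsCompactOperator.isFredholm_sub_smul {E : Type*} [NormedAddCommGroup E]
    [InnerProductSpace ℂ E] [CompleteSpace E] {R : E →L[ℂ] E} (hR : IsCompactOperator R)
    (hsa : IsSelfAdjoint R) {c : ℂ} (hc : c ≠ 0) :
    (R - c • ContinuousLinearMap.id ℂ E).IsFredholm := by
  have hsym := ContinuousLinearMap.isSelfAdjoint_iff_isSymmetric.1 hsa
  -- The eigenspace is finite-dimensional; on its invariant complement `c` is no longer an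
  -- eigenvalue, so `R - c` is invertible there.
  set V := End.eigenspace (R : End ℂ E) c with hV
  have hfin : FiniteDimensional ℂ V :=
    ContinuousLinearMap.finite_dimensional_eigenspace hR c hc
  have hinv : ∀ x ∈ Vᗮ, R x ∈ Vᗮ := hsym.invariant_orthogonalComplement_eigenspace c
  have hinv' : Set.MapsTo (R - c • ContinuousLinearMap.id ℂ E) Vᗮ Vᗮ := fun x hx => by
    simpa using Vᗮ.sub_mem (hinv x hx) (Vᗮ.smul_mem c hx)
  have hcof : (Vᗮ).CoFG :=
    ((Submodule.fg_iff_finiteDimensional V).2 hfin).cofg_of_isCompl V.isCompl_orthogonal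
  refine .of_isInvertible_restrict (E₁ := Vᗮ) (F₁ := Vᗮ) V.isClosed_orthogonal
    V.isClosed_orthogonal hinv' ?_
  let R' : Vᗮ →L[ℂ] Vᗮ := R.restrict hinv
  have hR' : IsCompactOperator R' := IsCompactOperator.restrict' (f := R.toLinearMap) hR hinv
  rcases hR'.hasEigenvalue_or_mem_resolventSet hc with he | hres
  · obtain ⟨x, hx, hx0⟩ := he.exists_hasEigenvector
    exfalso
    have hxV : (x : E) ∈ V := by
      rw [End.mem_eigenspace_iff] at hx ⊢
      exact congrArg Subtype.val hx
    exact hx0 (Subtype.ext (Submodule.disjoint_def.1 V.orthogonal_disjoint x hxV x.2))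
  · rw [spectrum.mem_resolventSet_iff, ← IsUnit.neg_iff] at hres
    have : (R - c • ContinuousLinearMap.id ℂ E).restrict hinv' =
        -(algebraMap ℂ (Vᗮ →L[ℂ] Vᗮ) c - R') := by
      ext x
      simp only [R', Algebra.algebraMap_eq_smul_one, neg_sub]
      rfl
    rw [this]
    obtain ⟨u, hu⟩ := hres
    exact ⟨ContinuousLinearEquiv.ofUnit u, hu⟩

/-- A quasi-inverse would make the identity compact up to finite rank, hence compact. -/
theorem IsCompactOperator.not_isFredholm {E F : Type*} [NormedAddCommGroup E]
    [NormedSpace ℂ E] [CompleteSpace E] [NormedAddCommGroup F] [NormedSpace ℂ F]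
    {R : E →L[ℂ] F} (hR : IsCompactOperator R) (hE : ¬ FiniteDimensional ℂ E) :
    ¬ R.IsFredholm := by
  intro h
  obtain ⟨v, hv⟩ := h.exists_isQuasiInverse
  have h1 : ((v ∘L R - ContinuousLinearMap.id ℂ E : E →L[ℂ] E) : E →ₗ[ℂ] E).HasNoetherianRange :=
    LinearMap.FiniteRangeSetoid.equiv_iff_hasNoetherianRange.1 hv.1
  have h2 : FiniteDimensional ℂ (v ∘L R - ContinuousLinearMap.id ℂ E).range :=
    .of_fg h1.hasFiniteRange
  have h3 := (hR.clm_comp v).sub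
    (IsCompactOperator.of_finiteDimensional_range (v ∘L R - ContinuousLinearMap.id ℂ E))
  refine hE (FiniteDimensional.of_isCompactOperator_id (𝕜 := ℂ) ?_)
  have h4 : (id : E → E) = ⇑(v ∘L R) - ⇑(v ∘L R - ContinuousLinearMap.id ℂ E) := by
    ext x
    simp
  rw [h4]
  exact h3

theorem essSpectrum_eq_singleton {E : Type*} [NormedAddCommGroup E]
    [InnerProductSpace ℂ E] [CompleteSpace E] (hE : ¬ FiniteDimensional ℂ E) {A : E →L[ℂ] E}
    (hA : IsSelfAdjoint A) {β : ℝ}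
    (h : IsCompactOperator (A - (β : ℂ) • ContinuousLinearMap.id ℂ E)) :
    essSpectrum A = {(β : ℂ)} := by
  ext μ
  simp only [essSpectrum, Set.mem_ofPred_eq, Set.mem_singleton_iff]
  refine ⟨fun hμ => ?_, ?_⟩
  · by_contra hne
    refine hμ ?_
    have hsa : IsSelfAdjoint (A - (β : ℂ) • ContinuousLinearMap.id ℂ E) :=
      hA.sub (.smul (Complex.conj_ofReal β) (.one _))
    have := h.isFredholm_sub_smul hsa (sub_ne_zero.2 hne)
    rwa [sub_smul, sub_sub, add_sub_cancel] at this
  · rintro rfl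
    exact h.not_isFredholm hE

/-! ### Asymptotics of `‖T x‖ ^ 2`. -/

theorem norm_sum_smul_sq_of_pairwise_inner_eq_zero {ι F : Type*} [NormedAddCommGroup F]
    [InnerProductSpace ℂ F] {g : ι → F} (hg : Pairwise fun i j => inner ℂ (g i) (g j) = 0)
    (s : Finset ι) (l : ι → ℂ) :
    ‖∑ i ∈ s, l i • g i‖ ^ 2 = ∑ i ∈ s, ‖l i‖ ^ 2 * ‖g i‖ ^ 2 := by
  classical
  induction s using Finset.induction_on with
  | empty => simp
  | insert a s ha ih =>
    rw [Finset.sum_insert ha, Finset.sum_insert ha, ← ih]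
    have h0 : inner ℂ (l a • g a) (∑ i ∈ s, l i • g i) = 0 := by
      rw [inner_sum]
      refine Finset.sum_eq_zero fun i hi => ?_
      rw [inner_smul_left, inner_smul_right, hg (by rintro rfl; exact ha hi)]
      simp
    have := norm_add_sq_eq_norm_sq_add_norm_sq_of_inner_eq_zero _ _ h0
    rw [sq, this, norm_smul]
    ring

/-- Intermediate values of the quadratic form `‖T x‖ ^ 2` on the unit sphere of a subspace. -/
theorem exists_mem_norm_eq_one_norm_map_sq_eq {E F : Type*} [NormedAddCommGroup E]
    [InnerProductSpace ℂ E] [NormedAddCommGroup F] [InnerProductSpace ℂ F] (T : E →L[ℂ] F)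
    (W : Submodule ℂ E) {c : ℝ} {x y : E} (hx : x ∈ W) (hy : y ∈ W)
    (hxc : ‖T x‖ ^ 2 < c * ‖x‖ ^ 2) (hyc : c * ‖y‖ ^ 2 < ‖T y‖ ^ 2) :
    ∃ z ∈ W, ‖z‖ = 1 ∧ ‖T z‖ ^ 2 = c := by
  set γ : ℝ → E := fun t => ((1 - t : ℝ) : ℂ) • x + (t : ℂ) • y with hγ
  have hcont : Continuous fun t => ‖T (γ t)‖ ^ 2 - c * ‖γ t‖ ^ 2 := by fun_prop
  obtain ⟨t, -, ht⟩ := intermediate_value_Icc (zero_le_one' ℝ) hcont.continuousOn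
    (show (0 : ℝ) ∈ _ by simp [hγ]; constructor <;> linarith)
  have hW : γ t ∈ W := W.add_mem (W.smul_mem _ hx) (W.smul_mem _ hy)
  -- If the segment met zero, `x` and `y` would be proportional, which the opposite strict
  -- inequalities exclude.
  have h0 : γ t ≠ 0 := by
    intro h0
    have e1 : ((1 - t : ℝ) : ℂ) • x = -((t : ℂ) • y) := eq_neg_of_add_eq_zero_left h0
    have e2 : (1 - t) ^ 2 * ‖x‖ ^ 2 = t ^ 2 * ‖y‖ ^ 2 := by
      have := congrArg (fun v => ‖v‖ ^ 2) e1
      simpa only [norm_neg, norm_smul, mul_pow, Complex.norm_real, Real.norm_eq_abs, sq_abs]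
        using this
    have e3 : (1 - t) ^ 2 * ‖T x‖ ^ 2 = t ^ 2 * ‖T y‖ ^ 2 := by
      have := congrArg (fun v => ‖T v‖ ^ 2) e1
      simpa only [map_neg, map_smul, norm_neg, norm_smul, mul_pow, Complex.norm_real,
        Real.norm_eq_abs, sq_abs] using this
    have e4 : (1 - t) ^ 2 * (c * ‖x‖ ^ 2 - ‖T x‖ ^ 2) + t ^ 2 * (‖T y‖ ^ 2 - c * ‖y‖ ^ 2) = 0 := by
      linear_combination c * e2 - e3
    have p1 := mul_nonneg (sq_nonneg (1 - t)) (sub_pos.2 hxc).le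
    have p2 := mul_nonneg (sq_nonneg t) (sub_pos.2 hyc).le
    have q1 : (1 - t) ^ 2 * (c * ‖x‖ ^ 2 - ‖T x‖ ^ 2) = 0 := by linarith
    have q2 : t ^ 2 * (‖T y‖ ^ 2 - c * ‖y‖ ^ 2) = 0 := by linarith
    have r1 := pow_eq_zero_iff two_ne_zero |>.1 <|
      (mul_eq_zero.1 q1).resolve_right (sub_pos.2 hxc).ne'
    have r2 := pow_eq_zero_iff two_ne_zero |>.1 <|
      (mul_eq_zero.1 q2).resolve_right (sub_pos.2 hyc).ne'
    linarith
  have hn : 0 < ‖γ t‖ := norm_pos_iff.2 h0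
  refine ⟨((‖γ t‖⁻¹ : ℝ) : ℂ) • γ t, W.smul_mem _ hW, ?_, ?_⟩
  · rw [norm_smul, Complex.norm_real, norm_inv, norm_norm, inv_mul_cancel₀ hn.ne']
  · rw [map_smul, norm_smul, Complex.norm_real, norm_inv, norm_norm, mul_pow]
    simp only at ht
    field_simp
    linarith

/-- If a bounded operator has orthogonal images of an orthonormal sequence, with norms strictly
above their limit, then its restriction to the closed span is not minimum attaining. -/
theorem not_isAbsMinAttaining_of_orthonormal {E F : Type*} [NormedAddCommGroup E]
    [InnerProductSpace ℂ E] [NormedAddCommGroup F] [InnerProductSpace ℂ F] {T : E →L[ℂ] F}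
    {f : ℕ → E} (hf : Orthonormal ℂ f)
    (hTf : Pairwise fun i j => inner ℂ (T (f i)) (T (f j)) = 0) {a : ℝ}
    (ha : ∀ n, a < ‖T (f n)‖ ^ 2) (hlim : ∀ ε > 0, ∃ n, ‖T (f n)‖ ^ 2 < a + ε) :
    ¬ IsAbsMinAttaining T := by
  intro hAM
  set M := (Submodule.span ℂ (Set.range f)).topologicalClosure with hM
  have hfM (n : ℕ) : f n ∈ M :=
    Submodule.le_topologicalClosure _ (Submodule.subset_span ⟨n, rfl⟩)
  have hM0 : M ≠ ⊥ := fun h => hf.ne_zero 0 (by simpa [h] using hfM 0)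
  obtain ⟨⟨x, hxM⟩, hx1, hxmin⟩ := hAM M (Submodule.isClosed_topologicalClosure _) hM0
  simp only [Submodule.coe_norm] at hx1
  have hmin (n : ℕ) : ‖T x‖ ≤ ‖T (f n)‖ :=
    hxmin.le.trans (minModulus_le _ (x := (⟨f n, hfM n⟩ : M)) (hf.1 n))
  have hTx : ‖T x‖ ^ 2 ≤ a := by
    refine le_of_forall_pos_le_add fun ε hε => ?_
    obtain ⟨n, hn⟩ := hlim ε hε
    exact le_trans (by gcongr; exact hmin n) hn.le
  -- On the span the right side is `∑ (‖T (f i)‖ ^ 2 - a) * ‖l i‖ ^ 2`, a sum of nonnegative terms;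
  -- keep the `n`-th and pass to the closure. A minimizer has right side `≤ 0`, so it is orthogonal
  -- to every `f n`.
  have key (n : ℕ) : ∀ y ∈ M,
      (‖T (f n)‖ ^ 2 - a) * ‖inner ℂ (f n) y‖ ^ 2 ≤ ‖T y‖ ^ 2 - a * ‖y‖ ^ 2 := by
    have hcl : IsClosed {y : E |
        (‖T (f n)‖ ^ 2 - a) * ‖inner ℂ (f n) y‖ ^ 2 ≤ ‖T y‖ ^ 2 - a * ‖y‖ ^ 2} :=
      isClosed_le (by fun_prop) (by fun_prop)
    refine fun y hy => closure_minimal (fun y hy => ?_) hcl hy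
    obtain ⟨l, rfl⟩ := (Finsupp.mem_span_range_iff_exists_finsupp).1 hy
    simp only [Set.mem_ofPred_eq, Finsupp.sum, map_sum, map_smul]
    rw [norm_sum_smul_sq_of_pairwise_inner_eq_zero hTf,
      norm_sum_smul_sq_of_pairwise_inner_eq_zero (fun i j hij => hf.2 hij)]
    have hin : inner ℂ (f n) (∑ i ∈ l.support, l i • f i) = l n := by
      have := hf.inner_right_finsupp l n
      rwa [Finsupp.linearCombination_apply, Finsupp.sum] at this
    rw [hin, Finset.mul_sum, ← Finset.sum_sub_distrib]
    have hterm (i : ℕ) : ‖l i‖ ^ 2 * ‖T (f i)‖ ^ 2 - a * (‖l i‖ ^ 2 * ‖f i‖ ^ 2) =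
        (‖T (f i)‖ ^ 2 - a) * ‖l i‖ ^ 2 := by
      rw [hf.1 i]; ring
    simp only [hterm]
    by_cases hn : n ∈ l.support
    · exact Finset.single_le_sum (f := fun i => (‖T (f i)‖ ^ 2 - a) * ‖l i‖ ^ 2)
        (fun i _ => mul_nonneg (sub_pos.2 (ha i)).le (sq_nonneg _)) hn
    · rw [Finsupp.notMem_support_iff.1 hn]
      simpa using Finset.sum_nonneg (f := fun i => (‖T (f i)‖ ^ 2 - a) * ‖l i‖ ^ 2)
        (fun i _ => mul_nonneg (sub_pos.2 (ha i)).le (sq_nonneg _))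
  have hperp (n : ℕ) : inner ℂ (f n) x = 0 := by
    have h1 := key n x hxM
    rw [hx1] at h1
    have h2 : (‖T (f n)‖ ^ 2 - a) * ‖inner ℂ (f n) x‖ ^ 2 ≤ 0 := by linarith
    by_contra hne
    exact h2.not_gt (mul_pos (sub_pos.2 (ha n)) (pow_pos (norm_pos_iff.2 hne) 2))
  have hMx : x ∈ Mᗮ := by
    rw [hM, Submodule.orthogonal_closure]
    exact Submodule.mem_orthogonal _ _ |>.2 fun u hu => by
      induction hu using Submodule.span_induction with
      | mem u hu => obtain ⟨n, rfl⟩ := hu; exact hperp n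
      | zero => simp
      | add u v _ _ hu hv => rw [inner_add_left, hu, hv, add_zero]
      | smul c u _ hu => rw [inner_smul_left, hu, mul_zero]
  have : x = 0 := Submodule.disjoint_def.1 M.orthogonal_disjoint x hxM hMx
  simp [this] at hx1

/-- Up to finite codimension, the quadratic form `‖T x‖ ^ 2` of an absolutely minimum attaining
operator lies on one side of any nondegenerate interval. -/
theorem IsAbsMinAttaining.exists_finiteDimensional_orthogonal {E F : Type*} [NormedAddCommGroup E]
    [InnerProductSpace ℂ E] [CompleteSpace E] [NormedAddCommGroup F] [InnerProductSpace ℂ F]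
    [CompleteSpace F] {T : E →L[ℂ] F} (hT : IsAbsMinAttaining T) {a b : ℝ} (hab : a < b) :
    ∃ V : Submodule ℂ E, FiniteDimensional ℂ V ∧
      ((∀ x ∈ Vᗮ, a * ‖x‖ ^ 2 ≤ ‖T x‖ ^ 2) ∨ ∀ x ∈ Vᗮ, ‖T x‖ ^ 2 ≤ b * ‖x‖ ^ 2) := by
  classical
  by_contra! hV
  have hval (V : Submodule ℂ E) (hfin : FiniteDimensional ℂ V) {c : ℝ} (hac : a ≤ c)
      (hcb : c ≤ b) : ∃ z ∈ Vᗮ, ‖z‖ = 1 ∧ ‖T z‖ ^ 2 = c := by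
    obtain ⟨⟨x, hx, hxa⟩, y, hy, hyb⟩ := hV V hfin
    refine exists_mem_norm_eq_one_norm_map_sq_eq T Vᗮ hx hy (hxa.trans_le ?_)
      (lt_of_le_of_lt ?_ hyb) <;> gcongr
  -- Orthogonality to `T* T p` makes the images orthogonal. The natural number carried by each
  -- vector increases strictly, which drives the values down to `a`.
  obtain ⟨f, hf, hf'⟩ := exists_seq_of_forall_finset_exists
    (fun p : ℕ × E => ‖p.2‖ = 1 ∧ ‖T p.2‖ ^ 2 = a + (b - a) / (p.1 + 1))
    (fun p q => p.1 < q.1 ∧ inner ℂ p.2 q.2 = 0 ∧ inner ℂ (T p.2) (T q.2) = 0) (by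
      intro s _
      set V := Submodule.span ℂ
        ((s.image Prod.snd ∪ s.image fun p => T.adjoint (T p.2) : Finset E) : Set E)
      set n := s.sup Prod.fst + 1
      obtain ⟨z, hz, hz1, hzc⟩ := hval V inferInstance (c := a + (b - a) / (n + 1))
        (le_add_of_nonneg_right (by have := sub_pos.2 hab; positivity)) (by
          have : (b - a) / (n + 1) ≤ b - a :=
            div_le_self (sub_pos.2 hab).le (by linarith [n.cast_nonneg (α := ℝ)])
          linarith)
      refine ⟨(n, z), ⟨hz1, hzc⟩, fun p hp => ⟨Nat.lt_succ_of_le (Finset.le_sup hp), ?_, ?_⟩⟩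
      · exact Submodule.inner_right_of_mem_orthogonal
          (Submodule.subset_span (by simp; exact .inl ⟨_, hp⟩)) hz
      · rw [← ContinuousLinearMap.adjoint_inner_left]
        exact Submodule.inner_right_of_mem_orthogonal
          (Submodule.subset_span (by simp; exact .inr ⟨_, _, hp, rfl⟩)) hz)
  have hmono : StrictMono fun n => (f n).1 := fun m n h => (hf' m n h).1
  refine not_isAbsMinAttaining_of_orthonormal (f := fun n => (f n).2) (a := a)
    ⟨fun n => (hf n).1, fun i j hij => ?_⟩ (fun i j hij => ?_) (fun n => ?_) (fun ε hε => ?_) hT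
  · rcases hij.lt_or_gt with h | h
    · exact (hf' _ _ h).2.1
    · exact inner_eq_zero_symm.1 (hf' _ _ h).2.1
  · rcases hij.lt_or_gt with h | h
    · exact (hf' _ _ h).2.2
    · exact inner_eq_zero_symm.1 (hf' _ _ h).2.2
  · rw [(hf n).2]
    have := sub_pos.2 hab
    exact lt_add_of_pos_right _ (by positivity)
  · obtain ⟨n, hn⟩ := exists_nat_gt ((b - a) / ε)
    refine ⟨n, ?_⟩
    rw [(hf n).2, add_lt_add_iff_left, div_lt_comm₀ (by positivity) hε]
    have : (n : ℝ) ≤ (f n).1 := by exact_mod_cast hmono.id_le n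
    linarith

theorem inner_self_eq_coe_norm_sq {E : Type*} [NormedAddCommGroup E] [InnerProductSpace ℂ E]
    (x : E) : inner ℂ x x = ((‖x‖ ^ 2 : ℝ) : ℂ) := by
  rw [inner_self_eq_norm_sq_to_K, Complex.ofReal_pow]; rfl

theorem exists_mem_orthogonal_ne_zero {E : Type*} [NormedAddCommGroup E]
    [InnerProductSpace ℂ E] (hE : ¬ FiniteDimensional ℂ E) (V : Submodule ℂ E)
    [FiniteDimensional ℂ V] : ∃ x ∈ Vᗮ, x ≠ 0 := by
  refine Submodule.exists_mem_ne_zero_of_ne_bot fun h => hE ?_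
  rw [Submodule.orthogonal_eq_bot_iff] at h
  subst h
  exact Module.Finite.equiv (Submodule.topEquiv (R := ℂ) (M := E))

/-- The quadratic form `‖T x‖ ^ 2` of an absolutely minimum attaining operator is
asymptotically constant. -/
theorem IsAbsMinAttaining.exists_abs_sub_le {E F : Type*} [NormedAddCommGroup E]
    [InnerProductSpace ℂ E] [CompleteSpace E] [NormedAddCommGroup F] [InnerProductSpace ℂ F]
    [CompleteSpace F] (hE : ¬ FiniteDimensional ℂ E) {T : E →L[ℂ] F} (hT : IsAbsMinAttaining T) :
    ∃ β : ℝ, 0 ≤ β ∧ ∀ ε > 0, ∃ V : Submodule ℂ E, FiniteDimensional ℂ V ∧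
      ∀ x ∈ Vᗮ, |‖T x‖ ^ 2 - β ^ 2 * ‖x‖ ^ 2| ≤ ε * ‖x‖ ^ 2 := by
  set S : Set ℝ := {a | ∃ V : Submodule ℂ E, FiniteDimensional ℂ V ∧
    ∀ x ∈ Vᗮ, a * ‖x‖ ^ 2 ≤ ‖T x‖ ^ 2} with hS
  have h0 : (0 : ℝ) ∈ S := ⟨⊥, inferInstance, fun x _ => by simp⟩
  have hbdd : BddAbove S := by
    refine ⟨‖T‖ ^ 2, ?_⟩
    rintro a ⟨V, hV, ha⟩
    obtain ⟨x, hx, hx0⟩ := exists_mem_orthogonal_ne_zero hE V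
    have h1 : a * ‖x‖ ^ 2 ≤ ‖T‖ ^ 2 * ‖x‖ ^ 2 := by
      rw [← mul_pow]
      exact (ha x hx).trans (by gcongr; exact T.le_opNorm x)
    exact le_of_mul_le_mul_right h1 (pow_pos (norm_pos_iff.2 hx0) 2)
  -- `β ^ 2` is the best lower bound valid up to finite codimension; a larger value cannot be one,
  -- so the dichotomy yields the upper bound.
  refine ⟨√(sSup S), Real.sqrt_nonneg _, fun ε hε => ?_⟩
  rw [Real.sq_sqrt (le_csSup hbdd h0)]
  obtain ⟨a, ⟨V, hV, hVa⟩, ha⟩ := exists_lt_of_lt_csSup ⟨0, h0⟩ (sub_lt_self (sSup S) hε)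
  obtain ⟨W, hW, hW'⟩ := hT.exists_finiteDimensional_orthogonal
    (show sSup S + ε / 2 < sSup S + ε by linarith)
  have hWb : ∀ x ∈ Wᗮ, ‖T x‖ ^ 2 ≤ (sSup S + ε) * ‖x‖ ^ 2 := by
    refine hW'.resolve_left fun h => ?_
    have := le_csSup hbdd (show _ ∈ S from ⟨W, hW, h⟩)
    linarith
  refine ⟨V ⊔ W, inferInstance, fun x hx => ?_⟩
  have h1 := hVa x (Submodule.orthogonal_le le_sup_left hx)
  have h2 := hWb x (Submodule.orthogonal_le le_sup_right hx)
  have h3 : (sSup S - ε) * ‖x‖ ^ 2 ≤ a * ‖x‖ ^ 2 := by gcongr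
  rw [abs_le]
  constructor <;> linarith

/-! ### Compact perturbations of scalars. -/

theorem ContinuousLinearMap.IsPositive.isUnit_add_smul {E : Type*} [NormedAddCommGroup E]
    [InnerProductSpace ℂ E] [CompleteSpace E] {A : E →L[ℂ] E} (hA : A.IsPositive) {β : ℝ}
    (hβ : 0 < β) : IsUnit (A + (β : ℂ) • ContinuousLinearMap.id ℂ E) := by
  refine ContinuousLinearMap.isUnit_of_forall_le_norm_inner_map _
    (c := ⟨β, hβ.le⟩) hβ fun x => ?_
  refine le_trans ?_ (Complex.re_le_norm _)
  have := hA.re_inner_nonneg_left x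
  simp only [RCLike.re_to_complex] at this
  simp only [add_apply, smul_apply,
    ContinuousLinearMap.id_apply, inner_add_left, inner_smul_left, Complex.add_re,
    Complex.conj_ofReal, Complex.re_ofReal_mul, inner_self_eq_coe_norm_sq, Complex.ofReal_re]
  change _ * β ≤ _
  linarith

theorem ContinuousLinearMap.IsPositive.add_smul_id {E : Type*} [NormedAddCommGroup E]
    [InnerProductSpace ℂ E] {A : E →L[ℂ] E} (hA : A.IsPositive) {β : ℝ} (hβ : 0 ≤ β) :
    (A + (β : ℂ) • ContinuousLinearMap.id ℂ E).IsPositive :=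
  hA.add (ContinuousLinearMap.isPositive_id.smul_of_nonneg (by exact_mod_cast hβ))

/-- A positive absolutely minimum attaining operator is a compact perturbation of a nonnegative
scalar. -/
theorem IsAbsMinAttaining.exists_isCompactOperator_sub {E : Type*} [NormedAddCommGroup E]
    [InnerProductSpace ℂ E] [CompleteSpace E] (hE : ¬ FiniteDimensional ℂ E) {T : E →L[ℂ] E}
    (hT : IsAbsMinAttaining T) (hpos : T.IsPositive) :
    ∃ β : ℝ, 0 ≤ β ∧ IsCompactOperator (T - (β : ℂ) • ContinuousLinearMap.id ℂ E) := by
  obtain ⟨β, hβ, h⟩ := hT.exists_abs_sub_le hE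
  refine ⟨β, hβ, ?_⟩
  -- For `β > 0`, `T - β = (T + β)⁻¹ (T ^ 2 - β ^ 2)`. For `β = 0` the inverse may not exist, but
  -- the estimate bounds `‖T x‖` directly.
  rcases hβ.eq_or_lt with rfl | hβ
  · refine .of_norm_le_on_orthogonal fun ε hε => ?_
    obtain ⟨V, hV, hx⟩ := h (ε ^ 2) (by positivity)
    refine ⟨V, hV, fun x hxV => ?_⟩
    have := (le_abs_self _).trans (hx x hxV)
    refine le_of_sq_le_sq ?_ (by positivity)
    simp [mul_pow] at this ⊢
    linarith
  · set I := ContinuousLinearMap.id ℂ E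
    have hsa := hpos.isSelfAdjoint
    have hR : IsCompactOperator (T * T - ((β : ℂ) ^ 2) • I) := by
      refine .of_abs_inner_le_on_orthogonal ?_ fun ε hε => ?_
      · refine IsSelfAdjoint.sub ?_ (.smul ?_ (.one _))
        · simpa [hsa.star_eq] using IsSelfAdjoint.mul_star_self T
        · rw [← Complex.ofReal_pow]
          exact Complex.conj_ofReal (β ^ 2)
      · obtain ⟨V, hV, hx⟩ := h ε hε
        refine ⟨V, hV, fun x hxV => ?_⟩
        convert hx x hxV using 2
        have e1 : inner ℂ (T (T x)) x = inner ℂ (T x) (T x) :=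
          hpos.inner_left_eq_inner_right _ _
        simp only [I, sub_apply, mul_apply_eq_comp,
          smul_apply, ContinuousLinearMap.id_apply, inner_sub_left, e1,
          inner_smul_left, inner_self_eq_coe_norm_sq, map_pow, Complex.conj_ofReal]
        norm_cast
    obtain ⟨u, hu⟩ := hpos.isUnit_add_smul hβ
    have e2 : T - (β : ℂ) • I = (u⁻¹ : (E →L[ℂ] E)ˣ) * (T * T - ((β : ℂ) ^ 2) • I) := by
      rw [Units.eq_inv_mul_iff_mul_eq, hu]
      ext x
      simp [I, sq, mul_smul, smul_sub]
    rw [e2]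
    exact hR.clm_comp (u⁻¹ : (E →L[ℂ] E)ˣ).1

/-! ### The form criterion and compressions. -/

theorem norm_map_le_add_norm_sub_smul {E : Type*} [NormedAddCommGroup E] [InnerProductSpace ℂ E]
    (T : E →L[ℂ] E) (β : ℝ) {x : E} (hx : ‖x‖ = 1) (hβ : 0 ≤ β) :
    ‖T x‖ ≤ β + ‖(T - (β : ℂ) • ContinuousLinearMap.id ℂ E) x‖ := by
  have : T x = (β : ℂ) • x + (T - (β : ℂ) • ContinuousLinearMap.id ℂ E) x := by simp
  calc ‖T x‖ ≤ ‖(β : ℂ) • x‖ + _ := by rw [this]; exact norm_add_le _ _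
    _ = _ := by rw [norm_smul, hx]; simp [abs_of_nonneg hβ]

theorem minModulus_comp_subtypeL_le {E : Type*} [NormedAddCommGroup E] [InnerProductSpace ℂ E]
    [CompleteSpace E] {T : E →L[ℂ] E} {β : ℝ} (hβ : 0 ≤ β)
    (h : IsCompactOperator (T - (β : ℂ) • ContinuousLinearMap.id ℂ E)) {M : Submodule ℂ E}
    (hM : IsClosed (M : Set E)) (hinf : ¬ FiniteDimensional ℂ M) :
    minModulus (T ∘L M.subtypeL) ≤ β := by
  have := hM.completeSpace_coe
  refine le_of_forall_pos_le_add fun ε hε => ?_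
  obtain ⟨x, hx, hxε⟩ := exists_norm_eq_one_norm_map_lt
    (R := (T - (β : ℂ) • ContinuousLinearMap.id ℂ E) ∘L M.subtypeL)
    (h.comp_clm M.subtypeL) hinf hε
  refine (minModulus_le _ hx).trans ?_
  have := norm_map_le_add_norm_sub_smul T β (x := (x : E)) hx hβ
  exact this.trans (by gcongr; exact hxε.le)

/-- A minimizer satisfies `‖T x‖ ≤ β`; Cauchy–Schwarz weakens this to a bound on the form, which
compressions preserve. -/
theorem IsAbsMinAttaining.exists_re_inner_le {E : Type*} [NormedAddCommGroup E]
    [InnerProductSpace ℂ E] [CompleteSpace E] {T : E →L[ℂ] E} (hT : IsAbsMinAttaining T) {β : ℝ}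
    (hβ : 0 ≤ β) (h : IsCompactOperator (T - (β : ℂ) • ContinuousLinearMap.id ℂ E))
    {M : Submodule ℂ E} (hM : IsClosed (M : Set E)) (hinf : ¬ FiniteDimensional ℂ M) :
    ∃ x ∈ M, x ≠ 0 ∧ (inner ℂ (T x) x).re ≤ β * ‖x‖ ^ 2 := by
  obtain ⟨x, hx, hxm⟩ := hT M hM (by rintro rfl; exact hinf inferInstance)
  have hle : ‖T x‖ ≤ β := hxm.le.trans (minModulus_comp_subtypeL_le hβ h hM hinf)
  replace hx : ‖(x : E)‖ = 1 := hx
  refine ⟨x, x.2, fun h0 => by simp [h0] at hx, ?_⟩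
  calc (inner ℂ (T x) (x : E)).re ≤ ‖T x‖ * ‖(x : E)‖ := re_inner_le_norm (𝕜 := ℂ) _ _
    _ ≤ β * ‖(x : E)‖ ^ 2 := by rw [hx]; simpa using hle

theorem CFC.norm_sqrt_apply_sq {E : Type*} [NormedAddCommGroup E] [InnerProductSpace ℂ E]
    [CompleteSpace E] {A : E →L[ℂ] E} (hA : A.IsPositive) (x : E) :
    ‖CFC.sqrt A x‖ ^ 2 = (inner ℂ (A x) x).re := by
  have hS : (CFC.sqrt A).IsPositive :=
    (ContinuousLinearMap.nonneg_iff_isPositive _).1 (CFC.sqrt_nonneg A)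
  have h1 : A x = CFC.sqrt A (CFC.sqrt A x) := by
    conv_lhs => rw [← CFC.sqrt_mul_sqrt_self A
      ((ContinuousLinearMap.nonneg_iff_isPositive _).2 hA)]
    rfl
  rw [h1, hS.inner_left_eq_inner_right, inner_self_eq_norm_sq_to_K]
  norm_cast

theorem ContinuousLinearMap.exists_pos_mul_norm_le_of_isUnit {E : Type*} [NormedAddCommGroup E]
    [NormedSpace ℂ E] {S : E →L[ℂ] E} (hS : IsUnit S) : ∃ c > 0, ∀ x, c * ‖x‖ ≤ ‖S x‖ := by
  obtain ⟨u, rfl⟩ := hS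
  refine ⟨(‖(u⁻¹ : (E →L[ℂ] E)ˣ).1‖ + 1)⁻¹, by positivity, fun x => ?_⟩
  rw [inv_mul_le_iff₀ (by positivity)]
  have h1 : (u⁻¹ : (E →L[ℂ] E)ˣ).1 (u.1 x) = x := by
    rw [← mul_apply_eq_comp, Units.inv_mul, one_apply_eq_self]
  calc ‖x‖ = ‖(u⁻¹ : (E →L[ℂ] E)ˣ).1 (u.1 x)‖ := by rw [h1]
    _ ≤ ‖(u⁻¹ : (E →L[ℂ] E)ˣ).1‖ * ‖u.1 x‖ := ContinuousLinearMap.le_opNorm _ _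
    _ ≤ _ := by gcongr; linarith

/-- A bounded operator `T` with `T* T` a compact perturbation of the scalar `c` attains its
minimum modulus unless the square of the latter is `c`. -/
theorem IsMinAttaining.of_isCompactOperator_sub {E F : Type*} [NormedAddCommGroup E]
    [InnerProductSpace ℂ E] [CompleteSpace E] [NormedAddCommGroup F] [InnerProductSpace ℂ F]
    [CompleteSpace F] [Nontrivial E] {T : E →L[ℂ] F} {c : ℝ}
    (h : IsCompactOperator (T.adjoint ∘L T - (c : ℂ) • ContinuousLinearMap.id ℂ E))
    (hc : minModulus T ^ 2 ≠ c) : IsMinAttaining T := by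
  set m := minModulus T with hm
  set I := ContinuousLinearMap.id ℂ E
  have hm0 : 0 ≤ m := le_minModulus T fun x _ => norm_nonneg _
  have hinner (x : E) : inner ℂ (T.adjoint (T x)) x = ((‖T x‖ ^ 2 : ℝ) : ℂ) := by
    rw [ContinuousLinearMap.adjoint_inner_left, inner_self_eq_coe_norm_sq]
  have hmle (x : E) : m ^ 2 * ‖x‖ ^ 2 ≤ ‖T x‖ ^ 2 := by
    rcases eq_or_ne x 0 with rfl | hx
    · simp
    have h1 := minModulus_le T (x := (‖x‖⁻¹ : ℂ) • x) (by simp [norm_smul, hx])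
    have hx' : 0 < ‖x‖ := norm_pos_iff.2 hx
    rw [map_smul, norm_smul, norm_inv, Complex.norm_real, norm_norm, ← hm,
      le_inv_mul_iff₀ hx'] at h1
    rw [← mul_pow, mul_comm]
    gcongr
  have hre (x : E) : inner ℂ ((T.adjoint ∘L T - ((m ^ 2 : ℝ) : ℂ) • I) x) x =
      ((‖T x‖ ^ 2 - m ^ 2 * ‖x‖ ^ 2 : ℝ) : ℂ) := by
    simp only [I, sub_apply, ContinuousLinearMap.comp_apply,
      smul_apply, ContinuousLinearMap.id_apply, inner_sub_left, hinner,
      inner_smul_left, Complex.conj_ofReal, inner_self_eq_coe_norm_sq]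
    norm_cast
  -- As `m ^ 2 ≠ c`, either `m ^ 2` is an eigenvalue of `T* T`, with a minimizing eigenvector, or
  -- `T* T - m ^ 2` is invertible.
  rcases h.hasEigenvalue_or_mem_resolventSet (μ := ((m ^ 2 - c : ℝ) : ℂ))
    (by exact_mod_cast sub_ne_zero.2 hc) with he | hres
  · obtain ⟨x, hx, hx0⟩ := he.exists_hasEigenvector
    rw [Module.End.mem_eigenspace_iff] at hx
    have hx2 : (T.adjoint ∘L T - ((m ^ 2 : ℝ) : ℂ) • I) x = 0 := by
      simp [I, sub_smul, sub_eq_iff_eq_add] at hx ⊢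
      exact hx
    have h1 := hre x
    rw [hx2, inner_zero_left] at h1
    have h2 : ‖T x‖ ^ 2 = m ^ 2 * ‖x‖ ^ 2 := by
      have : ‖T x‖ ^ 2 - m ^ 2 * ‖x‖ ^ 2 = 0 := by exact_mod_cast h1.symm
      linarith
    have h3 : ‖T x‖ = m * ‖x‖ := by
      rw [← mul_pow] at h2
      exact (sq_eq_sq₀ (norm_nonneg _) (by positivity)).1 h2
    refine .of_le (x := (‖x‖⁻¹ : ℂ) • x) (by simp [norm_smul, hx0]) ?_
    have hx' : 0 < ‖x‖ := norm_pos_iff.2 hx0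
    rw [map_smul, norm_smul, norm_inv, Complex.norm_real, norm_norm, h3, ← hm]
    field_simp
    exact le_rfl
  · exfalso
    -- `D` is positive and invertible, so its square root is bounded below by some `δ > 0`, forcing
    -- `‖T x‖ ^ 2 ≥ m ^ 2 + δ ^ 2` on the unit sphere.
    set D := T.adjoint ∘L T - ((m ^ 2 : ℝ) : ℂ) • I with hD
    have hDu : IsUnit D := by
      rw [spectrum.mem_resolventSet_iff, ← IsUnit.neg_iff] at hres
      convert hres using 1
      ext x
      simp [hD, I, Algebra.algebraMap_eq_smul_one, sub_smul]
    have hDpos : D.IsPositive := by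
      rw [ContinuousLinearMap.isPositive_iff_complex]
      intro x
      rw [hre x]
      exact ⟨by rw [RCLike.re_to_complex, Complex.ofReal_re], by
        simp only [RCLike.re_to_complex, Complex.ofReal_re]; linarith [hmle x]⟩
    obtain ⟨δ, hδ, hS⟩ := ContinuousLinearMap.exists_pos_mul_norm_le_of_isUnit
      ((CFC.isUnit_sqrt_iff D ((ContinuousLinearMap.nonneg_iff_isPositive _).2 hDpos)).2 hDu)
    have hlt : m < √(m ^ 2 + δ ^ 2) := Real.lt_sqrt_of_sq_lt (by have := pow_pos hδ 2; linarith)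
    refine hlt.not_ge (le_minModulus T fun x hx => ?_)
    refine Real.sqrt_le_iff.2 ⟨norm_nonneg _, ?_⟩
    have h1 := CFC.norm_sqrt_apply_sq hDpos x
    rw [hre x, Complex.ofReal_re, hx] at h1
    have h2 := hS x
    rw [hx, mul_one] at h2
    have h3 : δ ^ 2 ≤ ‖CFC.sqrt D x‖ ^ 2 := by gcongr
    linarith

/-- If a positive operator has no infinite-dimensional closed subspace on which its form exceeds
`β`, then every such subspace contains a unit vector with `‖A x‖ ≤ β`. -/
theorem ContinuousLinearMap.IsPositive.exists_norm_map_le {E : Type*} [NormedAddCommGroup E]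
    [InnerProductSpace ℂ E] [CompleteSpace E] {A : E →L[ℂ] E} (hA : A.IsPositive) {β : ℝ}
    (hβ : 0 ≤ β)
    (h : ∀ M : Submodule ℂ E, IsClosed (M : Set E) → ¬ FiniteDimensional ℂ M →
      ∃ x ∈ M, x ≠ 0 ∧ (inner ℂ (A x) x).re ≤ β * ‖x‖ ^ 2)
    {M : Submodule ℂ E} (hM : IsClosed (M : Set E)) (hinf : ¬ FiniteDimensional ℂ M) :
    ∃ x ∈ M, ‖x‖ = 1 ∧ ‖A x‖ ≤ β := by
  suffices ∃ y ∈ M, y ≠ 0 ∧ ‖A y‖ ≤ β * ‖y‖ by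
    obtain ⟨y, hyM, hy0, hy⟩ := this
    have hy' : 0 < ‖y‖ := norm_pos_iff.2 hy0
    refine ⟨(‖y‖⁻¹ : ℂ) • y, M.smul_mem _ hyM, by simp [norm_smul, hy0], ?_⟩
    rw [map_smul, norm_smul, norm_inv, Complex.norm_real, norm_norm, inv_mul_le_iff₀ hy']
    linarith
  rcases hβ.eq_or_lt with rfl | hβ
  · obtain ⟨x, hxM, hx0, hx⟩ := h M hM hinf
    refine ⟨x, hxM, hx0, ?_⟩
    have h1 : ‖CFC.sqrt A x‖ ^ 2 ≤ 0 := by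
      rw [CFC.norm_sqrt_apply_sq hA]; linarith
    have h2 : CFC.sqrt A x = 0 :=
      norm_eq_zero.1 (pow_eq_zero_iff two_ne_zero |>.1 (h1.antisymm (sq_nonneg _)))
    have h3 : A x = CFC.sqrt A (CFC.sqrt A x) := by
      conv_lhs => rw [← CFC.sqrt_mul_sqrt_self A
        ((ContinuousLinearMap.nonneg_iff_isPositive _).2 hA)]
      rfl
    rw [h3, h2]
    simp
  -- Apply the hypothesis to the image of `M` under `S = (A + β)^(1/2)`. For `x = S y` it reads `‖A
  -- y‖ ^ 2 + β ⟨A y, y⟩ ≤ β ⟨A y, y⟩ + β ^ 2 ‖y‖ ^ 2`, and the middle terms cancel.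
  · set B := A + (β : ℂ) • ContinuousLinearMap.id ℂ E with hB
    have hBpos : B.IsPositive := hA.add_smul_id hβ.le
    have hB0 : 0 ≤ B := (ContinuousLinearMap.nonneg_iff_isPositive _).2 hBpos
    set S := CFC.sqrt B with hS
    have hSS (y : E) : S (S y) = A y + (β : ℂ) • y := by
      rw [← mul_apply_eq_comp, CFC.sqrt_mul_sqrt_self B hB0]
      simp [hB]
    have hSpos : S.IsPositive :=
      (ContinuousLinearMap.nonneg_iff_isPositive _).1 (CFC.sqrt_nonneg B)
    obtain ⟨u, hu⟩ := (CFC.isUnit_sqrt_iff B hB0).2 (hA.isUnit_add_smul hβ)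
    let e := ContinuousLinearEquiv.ofUnit u
    have heS (y : E) : e y = S y := congrArg (fun L : E →L[ℂ] E => L y) hu
    obtain ⟨x, hx, hx0, hxle⟩ := h (M.map (e : E →ₗ[ℂ] E))
      (e.toHomeomorph.isClosed_image.2 hM)
      fun hfin => hinf (Module.Finite.equiv (e.toLinearEquiv.submoduleMap M).symm)
    obtain ⟨y, hyM, rfl⟩ := hx
    replace hxle : (inner ℂ (A (S y)) (S y)).re ≤ β * ‖S y‖ ^ 2 := by
      rw [← heS]; exact hxle
    refine ⟨y, hyM, by rintro rfl; simp at hx0, ?_⟩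
    have hcomm : S (A (S y)) = A (A y) + (β : ℂ) • A y := by
      have h1 : A (S y) = S (S (S y)) - (β : ℂ) • S y := by rw [hSS (S y)]; simp
      rw [h1, map_sub, map_smul, hSS (S (S y)), hSS y]
      simp
    have h1 : inner ℂ (A (S y)) (S y) = ((‖A y‖ ^ 2 : ℝ) : ℂ) + β * inner ℂ (A y) y := by
      rw [← hSpos.inner_left_eq_inner_right, hcomm, inner_add_left, inner_smul_left,
        Complex.conj_ofReal, hA.inner_left_eq_inner_right, inner_self_eq_coe_norm_sq]
    have h2 : ‖S y‖ ^ 2 = (inner ℂ (A y) y).re + β * ‖y‖ ^ 2 := by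
      rw [CFC.norm_sqrt_apply_sq hBpos]
      simp only [hB, add_apply, smul_apply, ContinuousLinearMap.id_apply, inner_add_left,
        inner_smul_left, Complex.conj_ofReal, inner_self_eq_coe_norm_sq, Complex.add_re,
        Complex.re_ofReal_mul, Complex.ofReal_re]
    rw [h1, h2, Complex.add_re, Complex.ofReal_re, Complex.re_ofReal_mul] at hxle
    refine le_of_sq_le_sq ?_ (by positivity)
    rw [mul_pow]
    nlinarith

/-- A positive compact perturbation of a scalar `β` whose form does not exceed `β` on any
infinite-dimensional closed subspace is absolutely minimum attaining. -/
theorem IsAbsMinAttaining.of_isCompactOperator_sub {E : Type*} [NormedAddCommGroup E]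
    [InnerProductSpace ℂ E] [CompleteSpace E] {A : E →L[ℂ] E} (hA : A.IsPositive) {β : ℝ}
    (hβ : 0 ≤ β) (hR : IsCompactOperator (A - (β : ℂ) • ContinuousLinearMap.id ℂ E))
    (h : ∀ M : Submodule ℂ E, IsClosed (M : Set E) → ¬ FiniteDimensional ℂ M →
      ∃ x ∈ M, x ≠ 0 ∧ (inner ℂ (A x) x).re ≤ β * ‖x‖ ^ 2) : IsAbsMinAttaining A := by
  intro M hM hM0
  have : Nontrivial M := Submodule.nontrivial_iff_ne_bot.2 hM0
  have := hM.completeSpace_coe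
  by_cases hfin : FiniteDimensional ℂ M
  · exact .of_finiteDimensional _
  by_cases hm : minModulus (A ∘L M.subtypeL) = β
  · obtain ⟨x, hxM, hx1, hx⟩ := hA.exists_norm_map_le hβ h hM hfin
    exact .of_le (x := (⟨x, hxM⟩ : M)) hx1 (hx.trans hm.ge)
  -- The restriction of `A` to `M` has Gram operator `β ^ 2` plus the compression of the compact `(A
  -- - β)(A + β)`.
  · refine .of_isCompactOperator_sub (c := β ^ 2) ?_ ?_
    · have hC := (hR.comp_clm ((A + (β : ℂ) • ContinuousLinearMap.id ℂ E) ∘L M.subtypeL)).clm_comp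
        (M.subtypeL.adjoint)
      have heq : (A ∘L M.subtypeL).adjoint ∘L (A ∘L M.subtypeL) -
          ((β ^ 2 : ℝ) : ℂ) • ContinuousLinearMap.id ℂ M = M.subtypeL.adjoint ∘L
            ((A - (β : ℂ) • ContinuousLinearMap.id ℂ E) ∘L
              ((A + (β : ℂ) • ContinuousLinearMap.id ℂ E) ∘L M.subtypeL)) := by
        refine ContinuousLinearMap.ext fun x => ext_inner_right ℂ fun y => ?_
        have h1 : ContinuousLinearMap.adjoint A = A := hA.isSelfAdjoint.adjoint_eq
        simp only [ContinuousLinearMap.adjoint_comp, h1, sub_apply, add_apply, smul_apply,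
          ContinuousLinearMap.comp_apply, ContinuousLinearMap.id_apply, inner_sub_left,
          ContinuousLinearMap.adjoint_inner_left, map_add, map_smul, inner_add_left,
          inner_smul_left, Complex.conj_ofReal, Submodule.subtypeL_apply, Submodule.coe_inner]
        push_cast
        ring
      rw [heq]
      exact hC
    · intro heq
      exact hm ((sq_eq_sq₀ (le_minModulus _ fun x _ => norm_nonneg _) hβ).1 heq)

/-- Compressions of a positive absolutely minimum attaining operator, given by an isometric
embedding, are absolutely minimum attaining. -/
theorem IsAbsMinAttaining.of_inner_map {E E' : Type*} [NormedAddCommGroup E]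
    [InnerProductSpace ℂ E] [CompleteSpace E] [NormedAddCommGroup E'] [InnerProductSpace ℂ E']
    [CompleteSpace E'] {T : E →L[ℂ] E} (hT : IsAbsMinAttaining T) {β : ℝ} (hβ : 0 ≤ β)
    (hR : IsCompactOperator (T - (β : ℂ) • ContinuousLinearMap.id ℂ E)) (J : E' →ₗᵢ[ℂ] E)
    {A : E' →L[ℂ] E'} (hA : A.IsPositive) (hJ : ∀ x y, inner ℂ (A x) y = inner ℂ (T (J x)) (J y)) :
    IsCompactOperator (A - (β : ℂ) • ContinuousLinearMap.id ℂ E') ∧ IsAbsMinAttaining A := by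
  have hc : IsCompactOperator (A - (β : ℂ) • ContinuousLinearMap.id ℂ E') := by
    have heq : A - (β : ℂ) • ContinuousLinearMap.id ℂ E' =
        J.toContinuousLinearMap.adjoint ∘L ((T - (β : ℂ) • ContinuousLinearMap.id ℂ E) ∘L
          J.toContinuousLinearMap) := by
      refine ContinuousLinearMap.ext fun x => ext_inner_right ℂ fun y => ?_
      simp [inner_sub_left, ContinuousLinearMap.adjoint_inner_left, hJ]
    rw [heq]
    exact (hR.comp_clm J.toContinuousLinearMap).clm_comp (J.toContinuousLinearMap.adjoint)
  refine ⟨hc, .of_isCompactOperator_sub hA hβ hc fun M hM hinf => ?_⟩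
  have := hM.completeSpace_coe
  obtain ⟨x, hx, hx0, hxle⟩ := hT.exists_re_inner_le hβ hR (M := M.map J.toLinearMap)
    (J.isometry.isClosedEmbedding.isClosedMap _ hM)
    fun hfin => hinf (Module.Finite.equiv
      (Submodule.equivMapOfInjective J.toLinearMap J.injective M).symm)
  obtain ⟨y, hy, rfl⟩ := hx
  refine ⟨y, hy, by rintro rfl; simp at hx0, ?_⟩
  rw [hJ]
  simpa using hxle

/-! ### The block operator. -/

theorem mainTheorem5
    {H₁ H₂ : Type*}
    [NormedAddCommGroup H₁] [InnerProductSpace ℂ H₁] [CompleteSpace H₁]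
    [TopologicalSpace.SeparableSpace H₁]
    [NormedAddCommGroup H₂] [InnerProductSpace ℂ H₂] [CompleteSpace H₂]
    [TopologicalSpace.SeparableSpace H₂]
    (hH₁ : ¬ FiniteDimensional ℂ H₁) (hH₂ : ¬ FiniteDimensional ℂ H₂)
    (A₁ : H₁ →L[ℂ] H₁) (A₂ : H₂ →L[ℂ] H₂) (X : H₂ →L[ℂ] H₁)
    (hA₁ : A₁.IsPositive) (hA₂ : A₂.IsPositive)
    (hT : (blockOperator A₁ X (ContinuousLinearMap.adjoint X) A₂).IsPositive)
    (hAM : IsAbsMinAttaining (blockOperator A₁ X (ContinuousLinearMap.adjoint X) A₂)) :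
    IsAbsMinAttaining A₁ ∧ IsAbsMinAttaining A₂ ∧
      essSpectrum A₁ = essSpectrum A₂ ∧ IsCompactOperator X := by
  let J₁ : H₁ →ₗᵢ[ℂ] WithLp 2 (H₁ × H₂) :=
    { toFun := fun x => WithLp.toLp 2 (x, 0)
      map_add' := fun x y => by rw [← WithLp.toLp_add]; simp
      map_smul' := fun c x => by rw [RingHom.id_apply, ← WithLp.toLp_smul]; simp
      norm_map' := WithLp.norm_toLp_fst 2 H₁ H₂ }
  let J₂ : H₂ →ₗᵢ[ℂ] WithLp 2 (H₁ × H₂) :=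
    { toFun := fun x => WithLp.toLp 2 (0, x)
      map_add' := fun x y => by rw [← WithLp.toLp_add]; simp
      map_smul' := fun c x => by rw [RingHom.id_apply, ← WithLp.toLp_smul]; simp
      norm_map' := WithLp.norm_toLp_snd 2 H₁ H₂ }
  have hinf : ¬ FiniteDimensional ℂ (WithLp 2 (H₁ × H₂)) := fun h =>
    hH₁ (Module.Finite.of_injective J₁.toLinearMap J₁.injective)
  obtain ⟨β, hβ, hR⟩ := hAM.exists_isCompactOperator_sub hinf hT
  obtain ⟨hc₁, hAM₁⟩ := hAM.of_inner_map hβ hR J₁ hA₁ fun x y => by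
    simp [J₁, blockOperator_apply, WithLp.prod_inner_apply]
  obtain ⟨hc₂, hAM₂⟩ := hAM.of_inner_map hβ hR J₂ hA₂ fun x y => by
    simp [J₂, blockOperator_apply, WithLp.prod_inner_apply]
  refine ⟨hAM₁, hAM₂, ?_, ?_⟩
  · rw [essSpectrum_eq_singleton hH₁ hA₁.isSelfAdjoint hc₁,
      essSpectrum_eq_singleton hH₂ hA₂.isSelfAdjoint hc₂]
  · have heq : X = J₁.toContinuousLinearMap.adjoint ∘L
        ((blockOperator A₁ X (ContinuousLinearMap.adjoint X) A₂ -
          (β : ℂ) • ContinuousLinearMap.id ℂ _) ∘L J₂.toContinuousLinearMap) := by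
      refine ContinuousLinearMap.ext fun x => ext_inner_right ℂ fun y => ?_
      rw [ContinuousLinearMap.comp_apply, ContinuousLinearMap.adjoint_inner_left]
      simp [J₁, J₂, blockOperator_apply, WithLp.prod_inner_apply, inner_sub_left]
    rw [heq]
    exact (hR.comp_clm J₂.toContinuousLinearMap).clm_comp (J₁.toContinuousLinearMap.adjoint)
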